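/- Let $k$ be a field of characteristic $0$ and let $f\in k[x,y]$ be a tame polynomial: for some positive integer weights $\deg x=\alpha_1$, $\deg y=\alpha_2$, the weighted homogeneous piece $g$ of $f$ of highest weighted degree has finite-dimensional Milnor vector space $V_g$. Here, for a polynomial $h$, $V_h:=k[x,y]/\langle \partial h/\partial x,\partial h/\partial y\rangle$. Let $A_f:V_f\to V_f$, $[P]\mapsto [Pf]$, and let $E_f$ be the $k[x,y]$-module of all algebraic $1$-forms $\omega$ on $\mathbb A^2_k$ such that $df\wedge\omega=f\alpha$ for some $2$-form $\alpha$. (1) Let $\Theta\in k[x,y]$ be a polynomial whose class in $V_f$ lies in $\ker(A_f)$ and satisfies $\Theta\cdot V_f=\ker(A_f)$. Then there is a $1$-form $\omega_\Theta$ with $f\,\Theta\,dx\wedge dy=df\wedge\omega_\Theta$, and for every such $\omega_\Theta$ the $k[x,y]$-module $E_f$ is generated by $f\,dx$, $f\,dy$, $df$ and $\omega_\Theta$. (2) Suppose that all Jordan blocks of $A_f$ for the eigenvalue $0$ have the same size, and that the minimal polynomial of $A_f$ is of the form $p(t)=t\,q(t)$ (that is, $0$ is an eigenvalue of $A_f$).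 Then every polynomial $\Theta_f\in k[x,y]$ with $\Theta_f=q(f)$ in $V_f$ has class in $\ker(A_f)$ and satisfies $\Theta_f\cdot V_f=\ker(A_f)$. (3) Let $\sigma:k\hookrightarrow\mathbb C$ be an embedding and suppose that every singular point $P\in\mathbb C^2$ of the curve $f=0$ (taken over $\mathbb C$ via $\sigma$) is quasi-homogeneous, i.e. there are local holomorphic coordinates $(u,v)$ centred at $P$ in which $f=a(u,v)\,g(u,v)$ with $a$ holomorphic, $a(P)\neq 0$, and $g$ a polynomial which is homogeneous of nonzero degree for some integer weights of $u$ and $v$. Then all Jordan blocks of $A_f$ for the eigenvalue $0$ have size $1$. -/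

import Mathlib

namespace PlaneCurve

open MvPolynomial KaehlerDifferential
open scoped Topology

/-- The polynomial ring `k[x, y]`, with `x = X 0` and `y = X 1`. -/
abbrev Poly (k : Type*) [Field k] : Type _ := MvPolynomial (Fin 2) k

section Algebraic

variable {k : Type*} [Field k]

/-- The Jacobian ideal `⟨∂f/∂x, ∂f/∂y⟩`. -/
noncomputable def jacob (f : Poly k) : Ideal (Poly k) := Ideal.span {pderiv 0 f, pderiv 1 f}

/-- The Milnor vector space `V_f = k[x, y] / jacob(f)`. -/
abbrev MilnorSpace (f : Poly k) : Type _ := Poly k ⧸ jacob f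

/-- The class `[P]` of a polynomial `P` in `V_f`. -/
noncomputable abbrev cls (f P : Poly k) : MilnorSpace f := Ideal.Quotient.mk (jacob f) P

/-- Multiplication by a polynomial `Θ` on `V_f`; its range is `Θ · V_f`. -/
noncomputable def mulMap (f Θ : Poly k) : Module.End k (MilnorSpace f) :=
  LinearMap.mulLeft k (cls f Θ)

/-- The map `A_f : V_f → V_f`, `[P] ↦ [P f]`. -/
noncomputable def A (f : Poly k) : Module.End k (MilnorSpace f) := mulMap f f

/-- `f` is tame: for some positive integer weights of `x` and `y`, the weighted homogeneous piece
of `f` of highest weighted degree has a finite-dimensional Milnor vector space. -/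
def IsTame (f : Poly k) : Prop :=
  ∃ w : Fin 2 → ℕ, (∀ i, 0 < w i) ∧
    Module.Finite k
      (MilnorSpace (weightedHomogeneousComponent w (weightedTotalDegree w f) f))

/-- The module `Ω¹` of algebraic 1-forms on the affine plane over `k`. -/
abbrev Form1 (k : Type*) [Field k] : Type _ := Ω[Poly k⁄k]

/-- The module `Ω²` of algebraic 2-forms on the affine plane over `k`. -/
abbrev Form2 (k : Type*) [Field k] : Type _ := ⋀[Poly k]^2 (Form1 k)

/-- The exterior differential of a polynomial. -/
noncomputable abbrev d (f : Poly k) : Form1 k := KaehlerDifferential.D k (Poly k) f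

/-- The 1-form `dx`. -/
noncomputable abbrev dx (k : Type*) [Field k] : Form1 k := d (X 0)

/-- The 1-form `dy`. -/
noncomputable abbrev dy (k : Type*) [Field k] : Form1 k := d (X 1)

/-- The wedge product of two 1-forms. -/
noncomputable def wedge (ω η : Form1 k) : Form2 k := exteriorPower.ιMulti (Poly k) 2 ![ω, η]

theorem wedge_add (ω η η' : Form1 k) : wedge ω (η + η') = wedge ω η + wedge ω η' := by
  have h := (exteriorPower.ιMulti (Poly k) 2 (M := Form1 k)).map_update_add ![ω, 0] 1 η η'
  have e : ∀ x : Form1 k, Function.update ![ω, 0] 1 x = ![ω, x] := fun x => by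
    ext i; fin_cases i <;> rfl
  rwa [e, e, e] at h

theorem wedge_smul (ω η : Form1 k) (P : Poly k) : wedge ω (P • η) = P • wedge ω η := by
  have h := (exteriorPower.ιMulti (Poly k) 2 (M := Form1 k)).map_update_smul ![ω, 0] 1 P η
  have e : ∀ x : Form1 k, Function.update ![ω, 0] 1 x = ![ω, x] := fun x => by
    ext i; fin_cases i <;> rfl
  rwa [e, e] at h

/-- The `k[x, y]`-module `E_f` of all 1-forms `ω` with `df ∧ ω = f α` for some 2-form `α`. -/
def E (f : Poly k) : Submodule (Poly k) (Form1 k) where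
  carrier := {ω | ∃ α : Form2 k, wedge (d f) ω = f • α}
  zero_mem' := ⟨0, by simpa using wedge_smul (d f) 0 0⟩
  add_mem' := by
    rintro ω η ⟨α, hα⟩ ⟨β, hβ⟩
    exact ⟨α + β, by rw [wedge_add, hα, hβ, smul_add]⟩
  smul_mem' := by
    rintro P ω ⟨α, hα⟩
    exact ⟨P • α, by rw [wedge_smul, hα, smul_comm]⟩

/-- `HasJordanBlocks T μ s`: the Jordan blocks of the endomorphism `T` for the eigenvalue `μ` are
`n` in number and have the sizes `s 0, …, s (n - 1)`. That is, the generalized eigenspace of `T`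
for `μ` has a basis `e i j`, `i < n`, `j < s i`, with `T (e i 0) = μ e i 0` and
`T (e i (j + 1)) = μ e i (j + 1) + e i j`. -/
def HasJordanBlocks {V : Type*} [AddCommGroup V] [Module k V] (T : Module.End k V) (μ : k)
    {n : ℕ} (s : Fin n → ℕ) : Prop :=
  (∀ i, 0 < s i) ∧
  ∃ e : Module.Basis (Σ i : Fin n, Fin (s i)) k (T.maxGenEigenspace μ),
    (∀ (i : Fin n) (h : 0 < s i), T (e ⟨i, ⟨0, h⟩⟩) = μ • (e ⟨i, ⟨0, h⟩⟩ : V)) ∧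
    ∀ (i : Fin n) (j : ℕ) (h : j + 1 < s i),
      T (e ⟨i, ⟨j + 1, h⟩⟩) = μ • (e ⟨i, ⟨j + 1, h⟩⟩ : V) + e ⟨i, ⟨j, Nat.lt_of_succ_lt h⟩⟩

/-- The Jordan blocks of `T` for the eigenvalue `μ` all have size `m` (there may be no block). -/
def JordanBlocksAllOfSize {V : Type*} [AddCommGroup V] [Module k V] (T : Module.End k V) (μ : k)
    (m : ℕ) : Prop :=
  ∃ n : ℕ, HasJordanBlocks T μ (fun _ : Fin n => m)

end Algebraic

/-- `p` is a singular point of the complex curve `F = 0`. -/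
def IsSingularPoint (F : Poly ℂ) (p : Fin 2 → ℂ) : Prop :=
  eval p F = 0 ∧ eval p (pderiv 0 F) = 0 ∧ eval p (pderiv 1 F) = 0

/-- The germ of the curve `F = 0` at `p` is quasi-homogeneous: in suitable holomorphic coordinates
`Φ` centred at `p` one has `F = a · g`, with `a` a holomorphic unit and `g` a polynomial that is
weighted homogeneous for integer weights of the coordinates, of nonzero degree. -/
def IsQuasiHomogeneousAt (F : Poly ℂ) (p : Fin 2 → ℂ) : Prop :=
  ∃ (Φ : (Fin 2 → ℂ) → (Fin 2 → ℂ)) (a : (Fin 2 → ℂ) → ℂ) (g : Poly ℂ) (w : Fin 2 → ℤ) (δ : ℤ),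
    AnalyticAt ℂ Φ p ∧ Φ p = 0 ∧ (fderiv ℂ Φ p).IsInvertible ∧
    AnalyticAt ℂ a p ∧ a p ≠ 0 ∧
    IsWeightedHomogeneous w g δ ∧ δ ≠ 0 ∧
    ∀ᶠ z in 𝓝 p, eval z F = a z * eval (Φ z) g

end PlaneCurve

/-!
A tame polynomial `f` has a finite-dimensional Milnor space (`IsTame.finite`): a power of each
variable lies in the Jacobian ideal of the top piece `g`, hence modulo the Jacobian ideal of `f` it
is a combination of monomials of smaller weight, and these relations reduce every monomial to
finitely many. Consequently the Jacobian ideal contains a polynomial in `x` alone and one in `y`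
alone, so that `f_x` and `f_y` have no common factor (`isRelPrime_pderiv`) and the 1-forms killed by
`df ∧ ·` are the multiples of `df`.

For the generators of `E_f`, a form `η` is in `E_f` exactly when `df ∧ η = f h dx ∧ dy` for some
`h`. Then `[h]` is in `ker A_f`, so `h` is a multiple `r Θ` of `Θ` up to the Jacobian ideal, and
`η - r ω_Θ` differs from a form killed by `df ∧ ·` by a combination of `f dx` and `f dy`
(`E_eq_span`).

If all Jordan blocks for `0` have size `m`, the minimal polynomial is `t q` with `q = t ^ a r`,
`r(0) ≠ 0` and `a < m`. The kernel of `A_f` consists of `a`-th images and `r(A_f)` is a nonzero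
scalar on it, whence `ker A_f = im q(A_f)` (`JordanBlocksAllOfSize.range_aeval_eq_ker`); and `q(A_f)`
is multiplication by `Θ_f`.

The blocks have size `1` as soon as `f ^ 2 P ∈ jacob f` implies `f P ∈ jacob f`. A `k`-linear
retraction of `ℂ` onto `k` reduces this to `k = ℂ` (`mem_jacob_of_map_mem`), where it can be checked
at each point by the Nullstellensatz (`mul_mem_jacob_of_quasiHomogeneous`). The only points that
matter are the singular points of the curve. There, the Euler vector field of the quasi-homogeneous
form writes `f` as a combination of `f_x` and `f_y` with analytic coefficients
(`IsQuasiHomogeneousAt.exists_analytic`). Replacing these by their Taylor polynomials shows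
`f ∈ jacob f + 𝔪 ^ N` for every `N`, and Krull's intersection theorem gives the local membership of
`f` in the Jacobian ideal (`exists_mul_mem_jacob_of_analytic`).
-/

/-! ### Tame polynomials have a finite-dimensional Milnor space -/

namespace PlaneCurve

open MvPolynomial

section Finiteness

variable {k : Type*} [Field k]

/-- If `k[x, y] / J` is finite-dimensional, then `J` contains a nonzero polynomial in each of the
two variables. -/
theorem exists_monic_aeval_X_mem {J : Ideal (Poly k)} (hJ : Module.Finite k (Poly k ⧸ J))
    (i : Fin 2) : ∃ u : Polynomial k, u.Monic ∧ Polynomial.aeval (X i : Poly k) u ∈ J := by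
  obtain ⟨u, hu, h0⟩ := IsIntegral.of_finite k (Ideal.Quotient.mk J (X i : Poly k))
  refine ⟨u, hu, Ideal.Quotient.eq_zero_iff_mem.mp ?_⟩
  rw [← Polynomial.aeval_def, ← Ideal.Quotient.mkₐ_eq_mk k, Polynomial.aeval_algHom_apply] at h0
  exact h0

/-- For a monic polynomial `u` in one variable, the leading term of `u(X i)` is one of its weighted
homogeneous components, the weights being positive. -/
theorem component_aeval_X {w : Fin 2 → ℕ} (hw : ∀ i, 0 < w i) (i : Fin 2) {u : Polynomial k}
    (hu : u.Monic) :
    weightedHomogeneousComponent w (u.natDegree * w i) (Polynomial.aeval (X i : Poly k) u) =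
      X i ^ u.natDegree := by
  rw [Polynomial.aeval_eq_sum_range, map_sum, Finset.sum_eq_single u.natDegree]
  · have h : IsWeightedHomogeneous w (X i ^ u.natDegree : Poly k) (u.natDegree * w i) := by
      simpa using (isWeightedHomogeneous_X k w i).pow u.natDegree
    rw [map_smul, h.weightedHomogeneousComponent_same, Polynomial.Monic.coeff_natDegree hu,
      one_smul]
  · intro n _ hn
    have h : IsWeightedHomogeneous w (X i ^ n : Poly k) (n * w i) := by
      simpa using (isWeightedHomogeneous_X k w i).pow n
    rw [map_smul, h.weightedHomogeneousComponent_ne, smul_zero]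
    exact fun e => hn (Nat.eq_of_mul_eq_mul_right (hw i) e).symm
  · intro h
    simp at h

/-- A weighted homogeneous component of a multiple of a weighted homogeneous polynomial `q` is the
product of `q` with a weighted homogeneous polynomial. The degree `D - v` of `q` is kept in the
form of a pair, as it would be negative when `q = 0` is a derivative. -/
theorem exists_mul_eq_component (w : Fin 2 → ℕ) {q : Poly k} {D v : ℕ}
    (hq : ∀ m ∈ q.support, Finsupp.weight w m + v = D) (d : ℕ) (c : Poly k) :
    ∃ c' : Poly k, (∀ m ∈ c'.support, Finsupp.weight w m + D = d + v) ∧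
      c' * q = weightedHomogeneousComponent w d (c * q) := by
  classical
  by_cases hD : D ≤ d + v
  · refine ⟨weightedHomogeneousComponent w (d + v - D) c, fun m hm => ?_, ?_⟩
    · rw [mem_support_iff, coeff_weightedHomogeneousComponent] at hm
      have : Finsupp.weight w m = d + v - D := by
        by_contra h
        simp [h] at hm
      omega
    · ext m
      rw [coeff_weightedHomogeneousComponent, coeff_mul]
      split_ifs with hm
      · rw [coeff_mul]
        refine Finset.sum_congr rfl fun x hx => ?_
        by_cases h0 : coeff x.2 q = 0
        · simp [h0]
        have h1 := hq _ (mem_support_iff.mpr h0)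
        have h2 : Finsupp.weight w x.1 + Finsupp.weight w x.2 = d := by
          rw [← map_add, Finset.HasAntidiagonal.mem_antidiagonal.mp hx, hm]
        rw [coeff_weightedHomogeneousComponent, if_pos (by omega)]
      · refine Finset.sum_eq_zero fun x hx => ?_
        by_cases h0 : coeff x.2 q = 0
        · simp [h0]
        have h1 := hq _ (mem_support_iff.mpr h0)
        have h2 : Finsupp.weight w x.1 + Finsupp.weight w x.2 = Finsupp.weight w m := by
          rw [← map_add, Finset.HasAntidiagonal.mem_antidiagonal.mp hx]
        rw [coeff_weightedHomogeneousComponent, if_neg (by omega), zero_mul]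
  · refine ⟨0, by simp, ?_⟩
    ext m
    rw [coeff_weightedHomogeneousComponent, zero_mul, coeff_zero]
    split_ifs with hm
    · rw [coeff_mul]
      refine (Finset.sum_eq_zero fun x hx => ?_).symm
      by_cases h0 : coeff x.2 q = 0
      · simp [h0]
      have h1 := hq _ (mem_support_iff.mpr h0)
      have h2 : Finsupp.weight w x.1 + Finsupp.weight w x.2 = d := by
        rw [← map_add, Finset.HasAntidiagonal.mem_antidiagonal.mp hx, hm]
      omega
    · rfl

theorem add_single_mem_support_of_mem_support_pderiv {i : Fin 2} {p : Poly k} {m : Fin 2 →₀ ℕ}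
    (hm : m ∈ (pderiv i p).support) : m + Finsupp.single i 1 ∈ p.support := by
  rw [mem_support_iff] at hm ⊢
  contrapose! hm
  rw [coeff_pderiv, hm, zero_mul]

theorem weight_of_mem_support_pderiv {w : Fin 2 → ℕ} {i : Fin 2} {p : Poly k} {m : Fin 2 →₀ ℕ}
    (hm : m ∈ (pderiv i p).support) :
    ∃ n ∈ p.support, Finsupp.weight w n = Finsupp.weight w m + w i :=
  ⟨_, add_single_mem_support_of_mem_support_pderiv hm, by
    rw [map_add, Finsupp.weight_single, one_smul]⟩

/-- If `c` is weighted homogeneous of degree `d - (D - v)` and `q` has only monomials of weight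
below `D - v`, then `c * q` has only monomials of weight below `d`. -/
theorem weight_lt_of_mem_support_mul {w : Fin 2 → ℕ} {c q : Poly k} {D v d : ℕ}
    (hc : ∀ m ∈ c.support, Finsupp.weight w m + D = d + v)
    (hq : ∀ m ∈ q.support, Finsupp.weight w m + v < D) :
    ∀ m ∈ (c * q).support, Finsupp.weight w m < d := by
  classical
  intro m hm
  obtain ⟨a, ha, b, hb, rfl⟩ := Finset.mem_add.mp (support_mul c q hm)
  have h1 := hc a ha
  have h2 := hq b hb
  rw [map_add]
  omega

/-- For a tame polynomial, modulo the Jacobian ideal a power of each variable is a combination of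
monomials of smaller weight: some power is `b₀ * g_x + b₁ * g_y` for the top piece `g` of `f`, with
`b₀`, `b₁` weighted homogeneous, and `f - g` contributes only terms of smaller weight. -/
theorem IsTame.exists_pow_reduction {f : Poly k} {w : Fin 2 → ℕ} (hw : ∀ i, 0 < w i)
    (hfin : Module.Finite k
      (MilnorSpace (weightedHomogeneousComponent w (weightedTotalDegree w f) f))) (i : Fin 2) :
    ∃ (a : ℕ) (r : Poly k), (∀ m ∈ r.support, Finsupp.weight w m < a * w i) ∧
      X i ^ a - r ∈ jacob f := by
  classical
  set D := weightedTotalDegree w f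
  set g := weightedHomogeneousComponent w D f with hg
  have hgs : ∀ m ∈ g.support, Finsupp.weight w m = D := fun m hm =>
    weightedHomogeneousComponent_isWeightedHomogeneous D f (mem_support_iff.mp hm)
  have hhs : ∀ m ∈ (f - g).support, Finsupp.weight w m < D := by
    intro m hm
    rw [mem_support_iff, coeff_sub, hg, coeff_weightedHomogeneousComponent] at hm
    have hne : Finsupp.weight w m ≠ D := fun h => by simp [h] at hm
    rw [if_neg hne, sub_zero] at hm
    exact lt_of_le_of_ne (le_weightedTotalDegree w (mem_support_iff.mpr hm)) hne
  have hgd : ∀ j, ∀ m ∈ (pderiv j g).support, Finsupp.weight w m + w j = D := fun j m hm => by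
    obtain ⟨n, hn, e⟩ := weight_of_mem_support_pderiv (w := w) hm
    rw [← e, hgs n hn]
  have hhd : ∀ j, ∀ m ∈ (pderiv j (f - g)).support, Finsupp.weight w m + w j < D := fun j m hm => by
    obtain ⟨n, hn, e⟩ := weight_of_mem_support_pderiv (w := w) hm
    rw [← e]
    exact hhs n hn
  obtain ⟨u, hu, hmem⟩ := exists_monic_aeval_X_mem hfin i
  obtain ⟨c₀, c₁, hc⟩ := Ideal.mem_span_pair.mp hmem
  obtain ⟨b₀, hb₀, e₀⟩ := exists_mul_eq_component w (hgd 0) (u.natDegree * w i) c₀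
  obtain ⟨b₁, hb₁, e₁⟩ := exists_mul_eq_component w (hgd 1) (u.natDegree * w i) c₁
  have key : X i ^ u.natDegree = b₀ * pderiv 0 g + b₁ * pderiv 1 g := by
    rw [e₀, e₁, ← map_add, hc, component_aeval_X hw i hu]
  refine ⟨u.natDegree, -(b₀ * pderiv 0 (f - g) + b₁ * pderiv 1 (f - g)), fun m hm => ?_, ?_⟩
  · rw [support_neg] at hm
    rcases Finset.mem_union.mp (support_add hm) with h | h
    · exact weight_lt_of_mem_support_mul hb₀ (hhd 0) m h
    · exact weight_lt_of_mem_support_mul hb₁ (hhd 1) m h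
  · refine Ideal.mem_span_pair.mpr ⟨b₀, b₁, ?_⟩
    rw [key, map_sub, map_sub]
    ring

/-- The Milnor space of a tame polynomial is finite-dimensional. By strong induction on the weight,
it is spanned by the monomials dividing a fixed one. -/
theorem IsTame.finite {f : Poly k} (hf : IsTame f) : Module.Finite k (MilnorSpace f) := by
  obtain ⟨w, hw, hfin⟩ := hf
  choose a r hr hmem using IsTame.exists_pow_reduction hw hfin
  let b : Fin 2 →₀ ℕ := Finsupp.equivFunOnFinite.symm a
  let S : Set (MilnorSpace f) := (fun m => cls f (monomial m 1)) '' Set.Iic b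
  have hS : S.Finite := (Set.finite_Iic b).image _
  have span_of (P : Poly k) (hP : ∀ m ∈ P.support, cls f (monomial m 1) ∈ Submodule.span k S) :
      cls f P ∈ Submodule.span k S := by
    rw [P.as_sum, cls, map_sum]
    refine Submodule.sum_mem _ fun m hm => ?_
    have : monomial m (coeff m P) = coeff m P • monomial m (1 : k) := by simp [smul_monomial]
    rw [this]
    exact Submodule.smul_mem _ (coeff m P) (hP m hm)
  have hmon (n : ℕ) : ∀ m : Fin 2 →₀ ℕ, Finsupp.weight w m = n →
      cls f (monomial m 1) ∈ Submodule.span k S := by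
    induction n using Nat.strong_induction_on with
    | _ n ih =>
      intro m hm
      by_cases hle : m ≤ b
      · exact Submodule.subset_span ⟨m, hle, rfl⟩
      obtain ⟨i, hi⟩ : ∃ i, b i < m i := by
        by_contra! h
        exact hle h
      have hsle : Finsupp.single i (a i) ≤ m := by
        rw [Finsupp.single_le_iff]
        exact hi.le
      obtain ⟨m', rfl⟩ := exists_add_of_le hsle
      have e : cls f (monomial (Finsupp.single i (a i) + m') 1) =
          cls f (r i * monomial m' 1) := by
        refine Ideal.Quotient.eq.mpr ?_
        have : monomial (Finsupp.single i (a i) + m') (1 : k) = X i ^ a i * monomial m' 1 := by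
          rw [X_pow_eq_monomial, monomial_mul, one_mul]
        rw [this, ← sub_mul]
        exact Ideal.mul_mem_right _ _ (hmem i)
      rw [e]
      refine span_of _ fun l hl => ih _ ?_ l rfl
      classical
      obtain ⟨x, hx, y, hy, rfl⟩ := Finset.mem_add.mp (support_mul _ _ hl)
      have hy' := Finset.mem_singleton.mp (support_monomial_subset hy)
      rw [← hm, hy', map_add, map_add, Finsupp.weight_single, smul_eq_mul]
      exact Nat.add_lt_add_right (hr i x hx) _
  refine ⟨⟨hS.toFinset, ?_⟩⟩
  rw [hS.coe_toFinset, eq_top_iff]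
  rintro v -
  obtain ⟨P, rfl⟩ := Ideal.Quotient.mk_surjective v
  exact span_of P fun m _ => hmon _ m rfl

end Finiteness

end PlaneCurve

/-! ### Two-forms on the plane and the module `E_f` -/

namespace PlaneCurve

open MvPolynomial KaehlerDifferential

section Forms

variable {k : Type*} [Field k]

/-- The coefficient of `dx` (for `i = 0`) or of `dy` (for `i = 1`) in a 1-form. -/
noncomputable def formCoeff (i : Fin 2) : Form1 k →ₗ[Poly k] Poly k :=
  (mvPolynomialBasis k (Fin 2)).coord i

@[simp] theorem formCoeff_d (i : Fin 2) (f : Poly k) : formCoeff i (d f) = pderiv i f :=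
  mvPolynomialBasis_repr_apply k (Fin 2) f i

theorem form_eq (ω : Form1 k) : ω = formCoeff 0 ω • dx k + formCoeff 1 ω • dy k := by
  conv_lhs => rw [← (mvPolynomialBasis k (Fin 2)).sum_repr ω]
  simp [Fin.sum_univ_two, formCoeff]

theorem form_ext {ω η : Form1 k} (h₀ : formCoeff 0 ω = formCoeff 0 η)
    (h₁ : formCoeff 1 ω = formCoeff 1 η) : ω = η := by
  rw [form_eq ω, form_eq η, h₀, h₁]

/-- The coefficient of `dx ∧ dy` in a 2-form. -/
noncomputable def areaCoeff : Form2 k →ₗ[Poly k] Poly k :=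
  exteriorPower.alternatingMapLinearEquiv (mvPolynomialBasis k (Fin 2)).det

theorem areaCoeff_wedge (ω η : Form1 k) : areaCoeff (wedge ω η) =
    formCoeff 0 ω * formCoeff 1 η - formCoeff 1 ω * formCoeff 0 η := by
  rw [areaCoeff, wedge, exteriorPower.alternatingMapLinearEquiv_apply_ιMulti,
    Module.Basis.det_apply, Matrix.det_fin_two]
  simp [Module.Basis.toMatrix_apply, formCoeff]
  ring

@[simp] theorem areaCoeff_wedge_dx_dy : areaCoeff (wedge (dx k) (dy k)) = 1 := by
  simp [areaCoeff_wedge, dx, dy, pderiv_X]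

theorem eq_areaCoeff_smul (α : Form2 k) : α = areaCoeff α • wedge (dx k) (dy k) := by
  have h : (LinearMap.id : Form2 k →ₗ[Poly k] Form2 k) =
      areaCoeff.smulRight (wedge (dx k) (dy k)) := by
    apply exteriorPower.linearMap_ext
    refine (mvPolynomialBasis k (Fin 2)).ext_alternating fun v hv => ?_
    have hvb : (fun i => mvPolynomialBasis k (Fin 2) (v i)) = ![d (X (v 0)), d (X (v 1))] := by
      ext i
      fin_cases i <;> simp [d]
    have swap : wedge (dy k) (dx k) = -wedge (dx k) (dy k) := by
      have := (exteriorPower.ιMulti (Poly k) 2 (M := Form1 k)).map_swap ![dx k, dy k]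
        (show (0 : Fin 2) ≠ 1 by decide)
      rw [wedge, wedge, ← this]
      congr 1
      ext i
      fin_cases i <;> rfl
    have key : ∀ a b : Fin 2, a ≠ b →
        wedge (d (X a : Poly k)) (d (X b)) =
          areaCoeff (wedge (d (X a : Poly k)) (d (X b))) • wedge (dx k) (dy k) := by
      intro a b hab
      fin_cases a <;> fin_cases b
      · exact absurd rfl hab
      · change wedge (dx k) (dy k) = areaCoeff (wedge (dx k) (dy k)) • _
        rw [areaCoeff_wedge_dx_dy, one_smul]
      · change wedge (dy k) (dx k) = areaCoeff (wedge (dy k) (dx k)) • _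
        rw [swap, map_neg, areaCoeff_wedge_dx_dy]
        exact (neg_one_smul (Poly k) _).symm
      · exact absurd rfl hab
    rw [hvb]
    exact key _ _ fun h => absurd (hv h) (by decide)
  exact LinearMap.congr_fun h α

theorem form2_ext {α β : Form2 k} (h : areaCoeff α = areaCoeff β) : α = β := by
  rw [eq_areaCoeff_smul α, eq_areaCoeff_smul β, h]

/-- Membership in `E_f` in coordinates. -/
theorem mem_E_iff {f : Poly k} {ω : Form1 k} :
    ω ∈ E f ↔ f ∣ pderiv 0 f * formCoeff 1 ω - pderiv 1 f * formCoeff 0 ω := by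
  constructor
  · rintro ⟨α, hα⟩
    have := congrArg areaCoeff hα
    rw [areaCoeff_wedge, map_smul, formCoeff_d, formCoeff_d] at this
    exact ⟨_, this⟩
  · rintro ⟨c, hc⟩
    refine ⟨c • wedge (dx k) (dy k), form2_ext ?_⟩
    rw [areaCoeff_wedge, formCoeff_d, formCoeff_d, hc]
    simp

theorem degreeOf_aeval_X {i j : Fin 2} (hij : i ≠ j) (u : Polynomial k) :
    degreeOf j (Polynomial.aeval (X i : Poly k) u) = 0 := by
  induction u using Polynomial.induction_on' with
  | add p q hp hq =>
    rw [map_add]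
    exact Nat.le_zero.mp ((degreeOf_add_le j _ _).trans (by simp [hp, hq]))
  | monomial n a =>
    rw [Polynomial.aeval_monomial]
    refine Nat.le_zero.mp ((degreeOf_C_mul_le _ j a).trans ?_)
    exact (degreeOf_pow_le j _ n).trans (by simp [degreeOf_X, hij.symm])

/-- If the Milnor space is finite-dimensional, the two partial derivatives have no common factor:
such a factor divides a polynomial in `x` alone and a polynomial in `y` alone. -/
theorem isRelPrime_pderiv {f : Poly k} (hf : Module.Finite k (MilnorSpace f)) :
    IsRelPrime (pderiv 0 f) (pderiv 1 f) := by
  intro p h₀ h₁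
  have hle : jacob f ≤ Ideal.span {p} := by
    rw [jacob, Ideal.span_le]
    rintro q (rfl | rfl)
    · exact Ideal.mem_span_singleton.mpr h₀
    · exact Ideal.mem_span_singleton.mpr h₁
  have hdeg {i j : Fin 2} (hij : i ≠ j) : p ≠ 0 ∧ degreeOf j p = 0 := by
    obtain ⟨u, hu, hmem⟩ := exists_monic_aeval_X_mem hf i
    obtain ⟨c, hc⟩ := Ideal.mem_span_singleton.mp (hle hmem)
    have hne : Polynomial.aeval (X i : Poly k) u ≠ 0 := fun h => by
      have := component_aeval_X (w := fun _ => 1) (fun _ => one_pos) i hu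
      rw [h, map_zero] at this
      exact pow_ne_zero _ (X_ne_zero i) this.symm
    have hd := degreeOf_aeval_X hij u
    rw [hc] at hne hd
    rw [degreeOf_mul_eq (left_ne_zero_of_mul hne) (right_ne_zero_of_mul hne)] at hd
    exact ⟨left_ne_zero_of_mul hne, by omega⟩
  have ht : p.totalDegree = 0 := by
    rw [totalDegree_eq_zero_iff]
    intro m hm i
    have : degreeOf i p = 0 := by
      fin_cases i
      · exact (hdeg (i := 1) (by decide)).2
      · exact (hdeg (i := 0) (by decide)).2
    exact Nat.le_zero.mp (this ▸ monomial_le_degreeOf i hm)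
  rw [totalDegree_eq_zero_iff_eq_C] at ht
  rw [ht]
  refine IsUnit.map C (IsUnit.mk0 _ fun h => (hdeg (i := 0) (j := 1) (by decide)).1 ?_)
  rw [ht, h, map_zero]

/-- The only syzygies of the partial derivatives are the trivial ones. -/
theorem eq_smul_d_of_wedge_eq_zero {f : Poly k} (hf : Module.Finite k (MilnorSpace f))
    {ω : Form1 k} (h : wedge (d f) ω = 0) : ∃ c : Poly k, ω = c • d f := by
  have hrel := isRelPrime_pderiv hf
  have h' := congrArg areaCoeff h
  rw [areaCoeff_wedge, map_zero, formCoeff_d, formCoeff_d, sub_eq_zero] at h'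
  obtain ⟨c, hc⟩ : pderiv 0 f ∣ formCoeff 0 ω :=
    hrel.dvd_of_dvd_mul_left (Dvd.intro _ h')
  obtain ⟨c', hc'⟩ : pderiv 1 f ∣ formCoeff 1 ω :=
    hrel.symm.dvd_of_dvd_mul_left (Dvd.intro _ h'.symm)
  by_cases h0 : pderiv 0 f = 0
  · refine ⟨c', form_ext ?_ ?_⟩
    · simp [hc, h0]
    · rw [hc', map_smul, formCoeff_d, smul_eq_mul, mul_comm]
  · refine ⟨c, form_ext ?_ ?_⟩
    · rw [hc, map_smul, formCoeff_d, smul_eq_mul, mul_comm]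
    · apply mul_left_cancel₀ h0
      rw [h', hc, map_smul, formCoeff_d, smul_eq_mul]
      ring

theorem mem_ker_A_iff {f P : Poly k} : cls f P ∈ LinearMap.ker (A f) ↔ f * P ∈ jacob f := by
  rw [LinearMap.mem_ker, ← Ideal.Quotient.eq_zero_iff_mem, map_mul]
  rfl

theorem exists_wedge_eq {f P : Poly k} (h : P ∈ jacob f) :
    ∃ ω : Form1 k, P • wedge (dx k) (dy k) = wedge (d f) ω := by
  obtain ⟨a, b, hab⟩ := Ideal.mem_span_pair.mp h
  refine ⟨a • dy k - b • dx k, form2_ext ?_⟩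
  rw [areaCoeff_wedge]
  simp [dx, dy, pderiv_X, ← hab]
  ring

/-- If `[Θ]` generates the annihilator of `[f]` in the Milnor algebra and
`f Θ dx ∧ dy = df ∧ ω`, then `E_f` is generated by `f dx`, `f dy`, `df` and `ω`. -/
theorem E_eq_span {f Θ : Poly k} (hf : Module.Finite k (MilnorSpace f))
    (hΘ : LinearMap.range (mulMap f Θ) = LinearMap.ker (A f)) {ω : Form1 k}
    (hω : (f * Θ) • wedge (dx k) (dy k) = wedge (d f) ω) :
    E f = Submodule.span (Poly k) {f • dx k, f • dy k, d f, ω} := by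
  have hω' := congrArg areaCoeff hω
  rw [areaCoeff_wedge, map_smul, formCoeff_d, formCoeff_d, areaCoeff_wedge_dx_dy, smul_eq_mul,
    mul_one] at hω'
  apply le_antisymm
  · intro η hη
    obtain ⟨h, hh⟩ := mem_E_iff.mp hη
    have hker : cls f h ∈ LinearMap.ker (A f) := by
      rw [mem_ker_A_iff, ← hh]
      exact Ideal.mem_span_pair.mpr ⟨formCoeff 1 η, - formCoeff 0 η, by ring⟩
    rw [← hΘ] at hker
    obtain ⟨v, hv⟩ := hker
    obtain ⟨r, rfl⟩ := Ideal.Quotient.mk_surjective v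
    have hv' : cls f h = cls f (Θ * r) := by
      rw [← hv, cls, map_mul]
      rfl
    obtain ⟨a, b, hab⟩ := Ideal.mem_span_pair.mp (Ideal.Quotient.eq.mp hv')
    obtain ⟨c, hc⟩ := eq_smul_d_of_wedge_eq_zero hf
      (ω := η - r • ω + b • f • dx k - a • f • dy k) (form2_ext (by
        rw [areaCoeff_wedge]
        simp only [map_sub, map_add, map_smul, formCoeff_d, smul_eq_mul, map_zero, pderiv_X]
        simp
        linear_combination hh + r * hω' - f * hab))
    have e : η = c • d f + r • ω - b • f • dx k + a • f • dy k := by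
      rw [← hc]
      abel
    rw [e]
    have hs := Submodule.subset_span (R := Poly k) (s := {f • dx k, f • dy k, d f, ω})
    exact add_mem (sub_mem (add_mem (Submodule.smul_mem _ _ (hs (by simp)))
      (Submodule.smul_mem _ _ (hs (by simp)))) (Submodule.smul_mem _ _ (hs (by simp))))
      (Submodule.smul_mem _ _ (hs (by simp)))
  · rw [Submodule.span_le]
    rintro η (rfl | rfl | rfl | rfl)
    · rw [SetLike.mem_coe, mem_E_iff]
      exact ⟨- pderiv 1 f, by simp [pderiv_X]; ring⟩
    · rw [SetLike.mem_coe, mem_E_iff]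
      exact ⟨pderiv 0 f, by simp [pderiv_X]; ring⟩
    · rw [SetLike.mem_coe, mem_E_iff]
      exact ⟨0, by simp; ring⟩
    · rw [SetLike.mem_coe, mem_E_iff, ← hω']
      exact Dvd.intro _ rfl

end Forms

end PlaneCurve

/-! ### Jordan blocks for the eigenvalue zero -/

namespace PlaneCurve

section Jordan

open Polynomial

variable {k V : Type*} [Field k] [AddCommGroup V] [Module k V]

/-- If the Jordan blocks for `0` all have size `m`, then a vector of the kernel is an `s`-th image
for every `s < m`: it is a combination of the first vectors of the Jordan chains. -/
theorem JordanBlocksAllOfSize.ker_le_range_pow {T : Module.End k V} {m s : ℕ}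
    (h : JordanBlocksAllOfSize T 0 m) (hs : s < m) :
    LinearMap.ker T ≤ LinearMap.range (T ^ s) := by
  classical
  obtain ⟨n, -, e, h0, h1⟩ := h
  simp only [zero_smul, zero_add] at h0 h1
  intro x hx
  have hxW : x ∈ T.maxGenEigenspace 0 := by
    rw [Module.End.mem_maxGenEigenspace]
    exact ⟨1, by simpa using hx⟩
  have chain (i : Fin n) (j : ℕ) (hj : j < m) :
      (T ^ j) (e ⟨i, ⟨j, hj⟩⟩ : V) = e ⟨i, ⟨0, j.zero_le.trans_lt hj⟩⟩ := by
    induction j with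
    | zero => simp
    | succ j ih => rw [pow_succ, Module.End.mul_apply, h1 i j hj, ih]
  have hT : Set.MapsTo T (T.maxGenEigenspace 0) (T.maxGenEigenspace 0) :=
    Module.End.mapsTo_maxGenEigenspace_of_comm rfl 0
  -- The coordinates of `T y` are those of `y`, shifted by one along the chains.
  have shift (i : Fin n) (j : ℕ) (hj : j + 1 < m) :
      (e.coord ⟨i, ⟨j, Nat.lt_of_succ_lt hj⟩⟩) ∘ₗ T.restrict hT = e.coord ⟨i, ⟨j + 1, hj⟩⟩ := by
    refine e.ext ?_
    rintro ⟨i', j', hj'⟩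
    rw [LinearMap.comp_apply]
    cases j' with
    | zero =>
      have : T.restrict hT (e ⟨i', ⟨0, hj'⟩⟩) = 0 := Subtype.ext (h0 i' hj')
      rw [this, map_zero]
      simp
    | succ l =>
      have : T.restrict hT (e ⟨i', ⟨l + 1, hj'⟩⟩) = e ⟨i', ⟨l, Nat.lt_of_succ_lt hj'⟩⟩ :=
        Subtype.ext (h1 i' l hj')
      rw [this]
      simp only [Module.Basis.coord_apply, Module.Basis.repr_self, Finsupp.single_apply]
      by_cases hi : i' = i
      · subst hi
        simp
      · simp [hi]
  have hzero (i : Fin n) (j : ℕ) (hj : j + 1 < m) : e.repr ⟨x, hxW⟩ ⟨i, ⟨j + 1, hj⟩⟩ = 0 := by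
    have := LinearMap.congr_fun (shift i j hj) ⟨x, hxW⟩
    rw [LinearMap.comp_apply, show T.restrict hT ⟨x, hxW⟩ = 0 from Subtype.ext hx, map_zero] at this
    exact this.symm
  have hsum := congrArg Subtype.val (e.sum_repr ⟨x, hxW⟩)
  rw [AddSubmonoidClass.coe_finsetSum] at hsum
  rw [← show _ = x from hsum]
  refine Submodule.sum_mem _ ?_
  rintro ⟨i, j, hj⟩ -
  cases j with
  | zero => exact Submodule.smul_mem _ _ ⟨_, chain i s hs⟩
  | succ j =>
    rw [hzero i j hj, zero_smul]
    exact zero_mem _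

theorem JordanBlocksAllOfSize.pow_eq_zero {T : Module.End k V} {m : ℕ}
    (h : JordanBlocksAllOfSize T 0 m) {x : V} (hx : x ∈ T.maxGenEigenspace 0) :
    (T ^ m) x = 0 := by
  obtain ⟨n, -, e, h0, h1⟩ := h
  simp only [zero_smul, zero_add] at h0 h1
  have chain (i : Fin n) (j : ℕ) (hj : j < m) : (T ^ (j + 1)) (e ⟨i, ⟨j, hj⟩⟩ : V) = 0 := by
    induction j with
    | zero => simpa using h0 i hj
    | succ j ih => rw [pow_succ, Module.End.mul_apply, h1 i j hj, ih]
  have : (T ^ m) ∘ₗ (T.maxGenEigenspace 0).subtype = 0 := by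
    refine e.ext ?_
    rintro ⟨i, j, hj⟩
    have hm : T ^ m = T ^ (m - (j + 1)) * T ^ (j + 1) := by
      rw [← pow_add, Nat.sub_add_cancel hj]
    rw [LinearMap.comp_apply, Submodule.subtype_apply, hm, Module.End.mul_apply, chain, map_zero,
      LinearMap.zero_apply]
  exact LinearMap.congr_fun this ⟨x, hx⟩

/-- Suppose that the Jordan blocks for `0` all have the same size `m`, and write the minimal
polynomial as `X * q` with `q = X ^ a * r`, `r(0) ≠ 0`. Then `a < m`, so a vector of the kernel is
an `a`-th image, and `r(T)` is the nonzero scalar `r(0)` on the kernel. -/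
theorem JordanBlocksAllOfSize.range_aeval_eq_ker [Module.Finite k V] {T : Module.End k V} {m : ℕ}
    (h : JordanBlocksAllOfSize T 0 m) {q : k[X]} (hq : minpoly k T = X * q) :
    LinearMap.range (aeval T q) = LinearMap.ker T := by
  have hp0 : minpoly k T ≠ 0 := minpoly.ne_zero (Algebra.IsIntegral.isIntegral T)
  have hTq : T * aeval T q = 0 := by
    rw [← minpoly.aeval k T, hq, map_mul, aeval_X]
  apply le_antisymm
  · rintro _ ⟨v, rfl⟩
    exact LinearMap.congr_fun hTq v
  have hq0 : q ≠ 0 := by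
    rintro rfl
    exact hp0 (by rw [hq, mul_zero])
  obtain ⟨r, hqr, hr⟩ := exists_eq_pow_rootMultiplicity_mul_and_not_dvd q hq0 0
  set a := rootMultiplicity 0 q
  rw [C_0, sub_zero] at hqr hr
  have hr0 : r.coeff 0 ≠ 0 := fun h => hr (X_dvd_iff.mpr h)
  have hrne : r ≠ 0 := fun h => hr0 (by simp [h])
  have hpr : minpoly k T = X ^ (a + 1) * r := by rw [hq, hqr, pow_succ']; ring
  have ham : a < m := by
    have hdvd : minpoly k T ∣ X ^ m * r := by
      apply minpoly.dvd
      ext v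
      rw [map_mul, map_pow, aeval_X, Module.End.mul_apply, LinearMap.zero_apply]
      apply h.pow_eq_zero
      rw [Module.End.mem_maxGenEigenspace]
      refine ⟨a + 1, ?_⟩
      have := LinearMap.congr_fun (minpoly.aeval k T) v
      rw [hpr, map_mul, map_pow, aeval_X] at this
      rwa [zero_smul, sub_zero]
    rw [hpr] at hdvd
    exact (pow_dvd_pow_iff X_ne_zero not_isUnit_X).mp ((mul_dvd_mul_iff_right hrne).mp hdvd)
  intro x hx
  obtain ⟨y, hy⟩ := h.ker_le_range_pow ham hx
  have hrx : aeval T r x = r.coeff 0 • x := by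
    conv_lhs => rw [← divX_mul_X_add r]
    rw [map_add, map_mul, aeval_X, aeval_C, LinearMap.add_apply, Module.End.mul_apply,
      LinearMap.mem_ker.mp hx, map_zero, zero_add, Module.algebraMap_end_apply]
  refine ⟨(r.coeff 0)⁻¹ • y, ?_⟩
  rw [map_smul, hqr, mul_comm, map_mul, map_pow, aeval_X, Module.End.mul_apply, hy, hrx, smul_smul,
    inv_mul_cancel₀ hr0, one_smul]

theorem jordanBlocksAllOfSize_one [Module.Finite k V] {T : Module.End k V}
    (h : ∀ v, T (T v) = 0 → T v = 0) : JordanBlocksAllOfSize T 0 1 := by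
  have hW (x : V) (hx : x ∈ T.maxGenEigenspace 0) : T x = 0 := by
    obtain ⟨n, hn⟩ := Module.End.mem_maxGenEigenspace T 0 x |>.mp hx
    rw [zero_smul, sub_zero] at hn
    induction n with
    | zero => simp at hn; simp [hn]
    | succ n ih =>
      cases n with
      | zero => simpa using hn
      | succ n =>
        apply ih
        rw [pow_succ', Module.End.mul_apply, pow_succ', Module.End.mul_apply] at hn
        rw [pow_succ', Module.End.mul_apply]
        exact h _ hn
  let b := Module.finBasis k (T.maxGenEigenspace 0)
  refine ⟨_, fun _ => one_pos, b.reindex (Equiv.sigmaUnique _ fun _ => Fin 1).symm, ?_, ?_⟩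
  · intro i _
    rw [zero_smul]
    exact hW _ (Subtype.prop _)
  · intro i j hj
    have hj' : j + 1 < 1 := hj
    omega

end Jordan

end PlaneCurve

/-! ### Taylor polynomials and membership in powers of a maximal ideal -/

namespace PlaneCurve

open MvPolynomial Asymptotics
open scoped Topology

section Taylor

/-- A function analytic at `p` agrees up to order `N` with a polynomial. -/
theorem exists_polynomial_isBigO {f : (Fin 2 → ℂ) → ℂ} {p : Fin 2 → ℂ} (hf : AnalyticAt ℂ f p)
    (N : ℕ) : ∃ Q : Poly ℂ, (fun y => f (p + y) - eval (p + y) Q) =O[𝓝 0] fun y => ‖y‖ ^ N := by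
  obtain ⟨P, hP⟩ := hf
  let Q : Poly ℂ := ∑ n ∈ Finset.range N, ∑ r : Fin n → Fin 2,
    C (P n fun i => Pi.single (r i) 1) * ∏ i, (X (r i) - C (p (r i)))
  suffices h : ∀ y, eval (p + y) Q = P.partialSum N y from
    ⟨Q, by simpa only [h] using hP.isBigO_sub_partialSum_pow N⟩
  intro y
  rw [FormalMultilinearSeries.partialSum, map_sum]
  refine Finset.sum_congr rfl fun n _ => ?_
  have hy : y = ∑ j, y j • (Pi.single j 1 : Fin 2 → ℂ) := by
    ext i
    fin_cases i <;> simp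
  conv_rhs => rw [hy, ContinuousMultilinearMap.map_sum]
  rw [map_sum]
  refine Finset.sum_congr rfl fun r _ => ?_
  rw [ContinuousMultilinearMap.map_smul_univ, map_mul, map_prod, eval_C, smul_eq_mul, mul_comm]
  simp

/-- A polynomial in one variable which is `O(|t| ^ N)` at `0` is divisible by `X ^ N`. -/
theorem X_pow_dvd_of_isBigO (N : ℕ) : ∀ q : Polynomial ℂ,
    (fun t => q.eval t) =O[𝓝[≠] 0] (fun t : ℂ => ‖t‖ ^ N) → Polynomial.X ^ N ∣ q := by
  induction N with
  | zero => intro q _; simp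
  | succ N ih =>
    intro q hq
    have h0 : q.eval 0 = 0 := by
      refine tendsto_nhds_unique (l := 𝓝[≠] (0 : ℂ)) (q.continuous.tendsto 0 |>.mono_left
        nhdsWithin_le_nhds) (hq.trans_tendsto ?_)
      have : Filter.Tendsto (fun t : ℂ => ‖t‖ ^ (N + 1)) (𝓝 0) (𝓝 (‖(0 : ℂ)‖ ^ (N + 1))) :=
        (continuous_norm.pow _).tendsto 0
      simpa using this.mono_left nhdsWithin_le_nhds
    obtain ⟨r, rfl⟩ : Polynomial.X ∣ q := by
      rwa [Polynomial.X_dvd_iff, Polynomial.coeff_zero_eq_eval_zero]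
    rw [pow_succ']
    refine mul_dvd_mul_left _ (ih r ?_)
    obtain ⟨c, hc⟩ := hq.bound
    refine IsBigO.of_bound c ?_
    filter_upwards [hc, self_mem_nhdsWithin] with t ht hne
    have hpos : 0 < ‖t‖ := norm_pos_iff.mpr hne
    rw [Polynomial.eval_mul, Polynomial.eval_X, norm_mul, norm_pow, norm_norm, pow_succ'] at ht
    rw [norm_pow, norm_norm]
    refine le_of_mul_le_mul_left ?_ hpos
    linarith

/-- The homogeneous components of `H` are the coefficients of its restrictions to lines. -/
theorem coeff_aeval_C_mul_X (H : Poly ℂ) (z : Fin 2 → ℂ) (j : ℕ) :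
    (aeval (fun i => Polynomial.C (z i) * Polynomial.X) H).coeff j =
      eval z (homogeneousComponent j H) := by
  induction H using MvPolynomial.induction_on' with
  | add p q hp hq => rw [map_add, Polynomial.coeff_add, hp, hq, map_add, map_add]
  | monomial m a =>
    have hm : IsHomogeneous (monomial m a) m.degree := isHomogeneous_monomial a rfl
    have e : aeval (fun i => Polynomial.C (z i) * Polynomial.X) (monomial m a) =
        Polynomial.C (eval z (monomial m a)) * Polynomial.X ^ m.degree := by
      rw [aeval_monomial, eval_monomial, Finsupp.degree_eq_sum, Finsupp.prod_fintype _ _ (by simp),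
        Finsupp.prod_fintype _ _ (by simp)]
      simp only [Fin.prod_univ_two, Fin.sum_univ_two, map_mul, map_pow, Polynomial.algebraMap_eq]
      ring
    rw [e, Polynomial.coeff_C_mul_X_pow,
      homogeneousComponent_of_mem ((mem_homogeneousSubmodule _ _).mpr hm)]
    split_ifs <;> simp

theorem mem_pow_idealOfVars_of_isBigO {H : Poly ℂ} {N : ℕ}
    (hH : (fun y => eval y H) =O[𝓝 0] fun y : Fin 2 → ℂ => ‖y‖ ^ N) :
    H ∈ idealOfVars (Fin 2) ℂ ^ N := by
  rw [mem_pow_idealOfVars_iff']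
  intro m hm
  have hcomp : homogeneousComponent m.degree H = 0 := by
    refine MvPolynomial.funext fun z => ?_
    rw [← coeff_aeval_C_mul_X, map_zero]
    refine Polynomial.X_pow_dvd_iff.mp (X_pow_dvd_of_isBigO N _ ?_) _ hm
    have ht : Filter.Tendsto (fun t : ℂ => t • z) (𝓝[≠] 0) (𝓝 0) := by
      have : Filter.Tendsto (fun t : ℂ => t • z) (𝓝 0) (𝓝 ((0 : ℂ) • z)) :=
        (continuous_id.smul continuous_const).tendsto 0
      rw [zero_smul] at this
      exact this.mono_left nhdsWithin_le_nhds
    have h1 := hH.comp_tendsto ht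
    have e : (fun t : ℂ => (aeval (fun i => Polynomial.C (z i) * Polynomial.X) H).eval t) =
        (fun y => eval y H) ∘ fun t : ℂ => t • z := by
      ext t
      have : (Polynomial.aeval t).comp
          (aeval (R := ℂ) fun i => Polynomial.C (z i) * (Polynomial.X : Polynomial ℂ)) =
          aeval (t • z) := by
        ext i
        rw [AlgHom.comp_apply, aeval_X, aeval_X, map_mul, Polynomial.aeval_C, Polynomial.aeval_X,
          Pi.smul_apply, smul_eq_mul, mul_comm]
        rfl
      have := AlgHom.congr_fun this H
      simpa [coe_aeval_eq_eval] using this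
    rw [e]
    refine h1.trans (IsBigO.of_bound (‖z‖ ^ N) (Filter.Eventually.of_forall fun t => ?_))
    simp [norm_smul, mul_pow, mul_comm]
  have := congrArg (coeff m) hcomp
  rwa [coeff_homogeneousComponent, if_pos rfl, coeff_zero] at this

/-- A polynomial vanishing to order `N` at `p` lies in the `N`-th power of the maximal ideal of
`p`. -/
theorem mem_pow_vanishingIdeal_of_isBigO {H : Poly ℂ} {p : Fin 2 → ℂ} {N : ℕ}
    (hH : (fun y => eval (p + y) H) =O[𝓝 0] fun y : Fin 2 → ℂ => ‖y‖ ^ N) :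
    H ∈ (vanishingIdeal ℂ {p} : Ideal (Poly ℂ)) ^ N := by
  let τ : Poly ℂ →ₐ[ℂ] Poly ℂ := aeval fun i => X i + C (p i)
  let τ' : Poly ℂ →ₐ[ℂ] Poly ℂ := aeval fun i => X i - C (p i)
  have hτ : τ' (τ H) = H := by
    have : τ'.comp τ = AlgHom.id ℂ _ := by
      ext i : 1
      simp [τ, τ']
    exact AlgHom.congr_fun this H
  have h1 : τ H ∈ idealOfVars (Fin 2) ℂ ^ N := by
    apply mem_pow_idealOfVars_of_isBigO
    convert hH using 2 with y
    have : (aeval y : Poly ℂ →ₐ[ℂ] ℂ).comp τ = aeval (p + y) := by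
      ext i
      simp [τ, add_comm]
    have := AlgHom.congr_fun this H
    simpa [coe_aeval_eq_eval] using this
  rw [← hτ]
  have h2 := Ideal.mem_map_of_mem τ' h1
  rw [Ideal.map_pow] at h2
  refine Ideal.pow_right_mono ?_ N h2
  rw [idealOfVars, Ideal.map_span, Ideal.span_le]
  rintro _ ⟨_, ⟨i, rfl⟩, rfl⟩
  simp [τ']

/-- If `F = B₀ F_x + B₁ F_y` near `p` with `B₀`, `B₁` analytic, then `F` lies in the Jacobian ideal
after localization at `p`: replacing `B₀`, `B₁` by Taylor polynomials, one finds `F` in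
`jacob F + 𝔪 ^ N` for all `N`, and Krull's intersection theorem applies. -/
theorem exists_mul_mem_jacob_of_analytic {F : Poly ℂ} {p : Fin 2 → ℂ} {B₀ B₁ : (Fin 2 → ℂ) → ℂ}
    (h₀ : AnalyticAt ℂ B₀ p) (h₁ : AnalyticAt ℂ B₁ p)
    (hF : ∀ᶠ z in 𝓝 p, eval z F = B₀ z * eval z (pderiv 0 F) + B₁ z * eval z (pderiv 1 F)) :
    ∃ s : Poly ℂ, eval p s ≠ 0 ∧ s * F ∈ jacob F := by
  have happrox (N : ℕ) : ∃ j ∈ jacob F, F - j ∈ (vanishingIdeal ℂ {p} : Ideal (Poly ℂ)) ^ N := by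
    obtain ⟨Q₀, hQ₀⟩ := exists_polynomial_isBigO h₀ N
    obtain ⟨Q₁, hQ₁⟩ := exists_polynomial_isBigO h₁ N
    refine ⟨_, Ideal.mem_span_pair.mpr ⟨Q₀, Q₁, rfl⟩, mem_pow_vanishingIdeal_of_isBigO ?_⟩
    have hbdd (D : Poly ℂ) : (fun y => eval (p + y) D) =O[𝓝 0] fun _ => (1 : ℝ) := by
      refine Filter.Tendsto.isBigO_one (c := eval p D) ℝ ?_
      have : Continuous fun y => eval (p + y) D :=
        (MvPolynomial.continuous_eval D).comp (continuous_const.add continuous_id)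
      simpa using this.tendsto 0
    have htr : Filter.Tendsto (fun y => p + y) (𝓝 0) (𝓝 p) := by
      have : Continuous fun y => p + y := continuous_const.add continuous_id
      simpa using this.tendsto 0
    refine (((hQ₀.mul (hbdd (pderiv 0 F))).add (hQ₁.mul (hbdd (pderiv 1 F)))).congr' ?_ ?_)
    · filter_upwards [htr.eventually hF] with y hy
      rw [map_sub, map_add, map_mul, map_mul, hy]
      ring
    · filter_upwards with y
      rw [mul_one]
  have hmem : Ideal.Quotient.mk (jacob F) F ∈
      (⨅ i : ℕ, (vanishingIdeal ℂ {p} : Ideal (Poly ℂ)) ^ i • ⊤ :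
        Submodule (Poly ℂ) (Poly ℂ ⧸ jacob F)) := by
    rw [Submodule.mem_iInf]
    intro N
    obtain ⟨j, hj, hN⟩ := happrox N
    have e : Ideal.Quotient.mk (jacob F) F = (F - j) • (1 : Poly ℂ ⧸ jacob F) := by
      change _ = Ideal.Quotient.mk (jacob F) ((F - j) * 1)
      exact Ideal.Quotient.eq.mpr (by simpa using hj)
    rw [e]
    exact Submodule.smul_mem_smul hN trivial
  obtain ⟨⟨r, hr⟩, hrF⟩ := (Ideal.mem_iInf_smul_pow_eq_bot_iff _ _).mp hmem
  refine ⟨1 - r, ?_, ?_⟩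
  · rw [mem_vanishingIdeal_singleton_iff] at hr
    have hr' : eval p r = 0 := by simpa [coe_aeval_eq_eval] using hr
    simp [hr']
  · rw [sub_mul, one_mul]
    exact Ideal.Quotient.eq.mp hrF.symm

end Taylor

end PlaneCurve

/-! ### Quasi-homogeneous singularities -/

namespace PlaneCurve

open MvPolynomial
open scoped Topology

section QuasiHomogeneous

theorem hasFDerivAt_eval (G : Poly ℂ) (z : Fin 2 → ℂ) :
    HasFDerivAt (fun z => eval z G)
      (∑ i, eval z (pderiv i G) • ContinuousLinearMap.proj (R := ℂ) (φ := fun _ => ℂ) i) z := by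
  induction G using MvPolynomial.induction_on with
  | C a =>
    simp only [eval_C]
    refine (hasFDerivAt_const (𝕜 := ℂ) a z).congr_fderiv ?_
    ext v
    simp
  | add p q hp hq =>
    simp only [map_add]
    refine (hp.fun_add hq).congr_fderiv ?_
    ext v
    simp
    ring
  | mul_X p i hp =>
    simp only [map_mul, eval_X]
    refine (hp.fun_mul (hasFDerivAt_apply i z)).congr_fderiv ?_
    ext v
    fin_cases i <;> simp [pderiv_X, Fin.sum_univ_two] <;> ring

theorem fderiv_eval_apply (G : Poly ℂ) (z v : Fin 2 → ℂ) :
    fderiv ℂ (fun z => eval z G) z v = ∑ i, eval z (pderiv i G) * v i := by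
  rw [(hasFDerivAt_eval G z).fderiv]
  simp

/-- Euler's identity for integer weights. -/
theorem sum_weight_mul_X_mul_pderiv {g : Poly ℂ} {w : Fin 2 → ℤ} {δ : ℤ}
    (hg : IsWeightedHomogeneous w g δ) :
    ∑ i, C (w i : ℂ) * (X i * pderiv i g) = C (δ : ℂ) * g := by
  conv_lhs => rw [g.as_sum]
  conv_rhs => rw [g.as_sum]
  simp only [map_sum, Finset.mul_sum]
  rw [Finset.sum_comm]
  refine Finset.sum_congr rfl fun m hm => ?_
  have hw : ∑ i, (m i : ℂ) * (w i : ℂ) = δ := by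
    have := hg (mem_support_iff.mp hm)
    rw [Finsupp.weight_apply, Finsupp.sum_fintype _ _ (by simp)] at this
    rw [← this]
    push_cast
    simp
  rw [← hw, map_sum, Finset.sum_mul]
  refine Finset.sum_congr rfl fun i _ => ?_
  rw [X_mul_pderiv_monomial, nsmul_eq_mul, C_mul, map_natCast]
  ring

/-- At a quasi-homogeneous point, `F` is a combination of its partial derivatives with analytic
coefficients. In coordinates `u`, `v` the Euler field `(w₀ u ∂_u + w₁ v ∂_v) / δ` fixes `g`; its
pull-back `ξ` vanishes at `p`, so that `ξ(F) = (a + ξ(a)) g` is a unit times `F = a g`. -/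
theorem IsQuasiHomogeneousAt.exists_analytic {F : Poly ℂ} {p : Fin 2 → ℂ}
    (h : IsQuasiHomogeneousAt F p) :
    ∃ B₀ B₁ : (Fin 2 → ℂ) → ℂ, AnalyticAt ℂ B₀ p ∧ AnalyticAt ℂ B₁ p ∧
      ∀ᶠ z in 𝓝 p, eval z F = B₀ z * eval z (pderiv 0 F) + B₁ z * eval z (pderiv 1 F) := by
  obtain ⟨Φ, a, g, w, δ, hΦ, hΦp, ⟨e, he⟩, ha, hap, hg, hδ, hF⟩ := h
  have hδ' : (δ : ℂ) ≠ 0 := by exact_mod_cast hδ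
  have hunit : IsUnit (fderiv ℂ Φ p) := by
    rw [← he]
    exact ⟨⟨e, e.symm, by ext; simp, by ext; simp⟩, rfl⟩
  let η : (Fin 2 → ℂ) → (Fin 2 → ℂ) := fun z i => (w i : ℂ) * Φ z i / δ
  let ξ : (Fin 2 → ℂ) → (Fin 2 → ℂ) := fun z => Ring.inverse (fderiv ℂ Φ z) (η z)
  have hη : AnalyticAt ℂ η p := by
    rw [analyticAt_pi_iff]
    intro i
    exact (analyticAt_const.mul (analyticAt_pi_iff.mp hΦ i)).div analyticAt_const hδ'
  have hξ : AnalyticAt ℂ ξ p := by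
    have hinv : AnalyticAt ℂ (fun z => Ring.inverse (fderiv ℂ Φ z)) p := by
      obtain ⟨u, hu⟩ := hunit
      exact (analyticAt_inverse (𝕜 := ℂ) u).comp_of_eq hΦ.fderiv hu.symm
    exact ((ContinuousLinearMap.id ℂ ((Fin 2 → ℂ) →L[ℂ] (Fin 2 → ℂ))).analyticAt_bilinear
      (Ring.inverse (fderiv ℂ Φ p), η p)).comp₂ hinv hη
  have hξp : ξ p = 0 := by
    have : η p = 0 := by
      ext i
      simp [η, hΦp]
    simp [ξ, this]
  let b : (Fin 2 → ℂ) → ℂ := fun z => fderiv ℂ a z (ξ z) + a z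
  have hb : AnalyticAt ℂ b p :=
    (((ContinuousLinearMap.id ℂ ((Fin 2 → ℂ) →L[ℂ] ℂ)).analyticAt_bilinear
      (fderiv ℂ a p, ξ p)).comp₂ ha.fderiv hξ).add ha
  have hbp : b p ≠ 0 := by simpa [b, hξp] using hap
  have hc (i : Fin 2) : AnalyticAt ℂ (fun z => a z / b z * ξ z i) p :=
    (ha.div hb hbp).mul (analyticAt_pi_iff.mp hξ i)
  refine ⟨_, _, hc 0, hc 1, ?_⟩
  have hunit' : ∀ᶠ z in 𝓝 p, IsUnit (fderiv ℂ Φ z) :=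
    hΦ.fderiv.continuousAt.eventually (Units.isOpen.mem_nhds hunit)
  filter_upwards [hunit', hF.eventually_nhds, hΦ.eventually_analyticAt, ha.eventually_analyticAt,
    hb.continuousAt.eventually_ne hbp] with z hz hFz hΦz haz hbz
  have hξz : fderiv ℂ Φ z (ξ z) = η z :=
    congrArg (fun T : (Fin 2 → ℂ) →L[ℂ] (Fin 2 → ℂ) => T (η z)) (Ring.mul_inverse_cancel _ hz)
  have hG : fderiv ℂ (fun z => eval (Φ z) g) z (ξ z) = eval (Φ z) g := by
    have hcomp := (hasFDerivAt_eval g (Φ z)).comp z hΦz.differentiableAt.hasFDerivAt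
    have : fderiv ℂ (fun z => eval (Φ z) g) z = _ := hcomp.fderiv
    rw [this, ContinuousLinearMap.comp_apply, hξz]
    have hE := congrArg (eval (Φ z)) (sum_weight_mul_X_mul_pderiv hg)
    simp only [Fin.sum_univ_two, map_add, map_mul, eval_C, eval_X] at hE
    simp [Fin.sum_univ_two, η]
    field_simp
    linear_combination hE
  have hdF : fderiv ℂ (fun z => eval z F) z (ξ z) = b z * eval (Φ z) g := by
    have hGd : DifferentiableAt ℂ (fun z => eval (Φ z) g) z :=
      (hasFDerivAt_eval g (Φ z)).differentiableAt.comp z hΦz.differentiableAt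
    rw [Filter.EventuallyEq.fderiv_eq (f := fun z => a z * eval (Φ z) g) hFz, fderiv_fun_mul haz.differentiableAt hGd]
    simp only [add_apply, smul_apply, smul_eq_mul, hG, b]
    ring
  rw [fderiv_eval_apply, Fin.sum_univ_two] at hdF
  rw [hFz.self_of_nhds]
  field_simp
  linear_combination -a z * hdF

/-- If the complex curve `F = 0` has only quasi-homogeneous singularities, then `F ^ 2 P` lies in
the Jacobian ideal only if `F P` does. This is checked at each point of the plane: outside the
critical points of `F` the ideal is trivial, at a critical point off the curve `F` is a unit, and at
a singular point of the curve `F` itself is locally in the ideal. -/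
theorem mul_mem_jacob_of_quasiHomogeneous {F : Poly ℂ}
    (hF : ∀ p : Fin 2 → ℂ, IsSingularPoint F p → IsQuasiHomogeneousAt F p) {P : Poly ℂ}
    (hP : F * (F * P) ∈ jacob F) : F * P ∈ jacob F := by
  let K : Ideal (Poly ℂ) := Submodule.comap (LinearMap.mulRight (Poly ℂ) (F * P)) (jacob F)
  have hK (s : Poly ℂ) : s ∈ K ↔ s * (F * P) ∈ jacob F := Iff.rfl
  by_contra hne
  have hKtop : K ≠ ⊤ := by
    rw [Ne, Ideal.eq_top_iff_one, hK, one_mul]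
    exact hne
  obtain ⟨M, hM, hKM⟩ := Ideal.exists_le_maximal K hKtop
  obtain ⟨p, rfl⟩ := isMaximal_iff_eq_vanishingIdeal_singleton.mp hM
  have hvan (s : Poly ℂ) (hs : s ∈ K) : eval p s = 0 := by
    simpa [mem_vanishingIdeal_singleton_iff, coe_aeval_eq_eval] using hKM hs
  have hsing : IsSingularPoint F p := by
    refine ⟨hvan _ hP, hvan _ ?_, hvan _ ?_⟩
    · exact Ideal.mul_mem_right _ _ (Ideal.subset_span (by simp))
    · exact Ideal.mul_mem_right _ _ (Ideal.subset_span (by simp))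
  obtain ⟨B₀, B₁, h₀, h₁, hB⟩ := (hF p hsing).exists_analytic
  obtain ⟨s, hs, hsF⟩ := exists_mul_mem_jacob_of_analytic h₀ h₁ hB
  refine hs (hvan s ?_)
  rw [hK, ← mul_assoc]
  exact Ideal.mul_mem_right _ _ hsF

end QuasiHomogeneous

section Descent

variable {k : Type*} [Field k]

/-- Membership in the Jacobian ideal descends along an extension of fields: apply a `k`-linear
retraction of the extension to the coefficients. -/
theorem mem_jacob_of_map_mem {L : Type*} [Field L] (σ : k →+* L) {f P : Poly k}
    (h : MvPolynomial.map σ P ∈ jacob (MvPolynomial.map σ f)) : P ∈ jacob f := by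
  let := σ.toAlgebra
  obtain ⟨ρ, hρ⟩ := LinearMap.exists_leftInverse_of_injective (Algebra.linearMap k L)
    (LinearMap.ker_eq_bot.mpr σ.injective)
  have hρ1 (c : L) (x : k) : ρ (c * σ x) = ρ c * x := by
    have : c * σ x = x • c := by rw [Algebra.smul_def, mul_comm]; rfl
    rw [this, map_smul, smul_eq_mul, mul_comm]
  let R : Poly L → Poly k := fun Q => ∑ m ∈ Q.support, monomial m (ρ (coeff m Q))
  have hR (Q : Poly L) (m : Fin 2 →₀ ℕ) : coeff m (R Q) = ρ (coeff m Q) := by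
    classical
    simp only [R, coeff_sum, coeff_monomial, Finset.sum_ite_eq']
    split_ifs with hm
    · rfl
    · rw [notMem_support_iff.mp hm, map_zero]
  have hRmul (Q : Poly L) (q : Poly k) : R (Q * MvPolynomial.map σ q) = R Q * q := by
    ext m
    simp only [hR, coeff_mul, map_sum, coeff_map, hρ1]
  have hRadd (Q Q' : Poly L) : R (Q + Q') = R Q + R Q' := by
    ext m
    simp only [hR, coeff_add, map_add]
  obtain ⟨c₀, c₁, hc⟩ := Ideal.mem_span_pair.mp h
  rw [pderiv_map, pderiv_map] at hc
  refine Ideal.mem_span_pair.mpr ⟨R c₀, R c₁, ?_⟩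
  rw [← hRmul, ← hRmul, ← hRadd, hc]
  ext m
  rw [hR, coeff_map]
  exact LinearMap.congr_fun hρ _

theorem map_mem_jacob {L : Type*} [Field L] (σ : k →+* L) {f P : Poly k} (h : P ∈ jacob f) :
    MvPolynomial.map σ P ∈ jacob (MvPolynomial.map σ f) := by
  obtain ⟨c₀, c₁, rfl⟩ := Ideal.mem_span_pair.mp h
  exact Ideal.mem_span_pair.mpr ⟨MvPolynomial.map σ c₀, MvPolynomial.map σ c₁, by
    simp [pderiv_map]⟩

theorem aeval_A (f : Poly k) (q : Polynomial k) :
    Polynomial.aeval (A f) q = mulMap f (Polynomial.aeval f q) := by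
  have h1 : mulMap f (Polynomial.aeval f q) = Algebra.lmul k (MilnorSpace f)
      (Ideal.Quotient.mkₐ k (jacob f) (Polynomial.aeval f q)) := rfl
  rw [h1, ← Polynomial.aeval_algHom_apply, ← Polynomial.aeval_algHom_apply]
  rfl

end Descent

end PlaneCurve

theorem theorem4 {k : Type*} [Field k] [CharZero k] (f : PlaneCurve.Poly k)
    (hf : PlaneCurve.IsTame f) :
    (∀ Θ : PlaneCurve.Poly k,
      PlaneCurve.cls f Θ ∈ LinearMap.ker (PlaneCurve.A f) →
      LinearMap.range (PlaneCurve.mulMap f Θ) = LinearMap.ker (PlaneCurve.A f) →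
      (∃ ω : PlaneCurve.Form1 k,
        (f * Θ) • PlaneCurve.wedge (PlaneCurve.dx k) (PlaneCurve.dy k) =
          PlaneCurve.wedge (PlaneCurve.d f) ω) ∧
      ∀ ω : PlaneCurve.Form1 k,
        (f * Θ) • PlaneCurve.wedge (PlaneCurve.dx k) (PlaneCurve.dy k) =
          PlaneCurve.wedge (PlaneCurve.d f) ω →
        PlaneCurve.E f = Submodule.span (PlaneCurve.Poly k)
          {f • PlaneCurve.dx k, f • PlaneCurve.dy k, PlaneCurve.d f, ω}) ∧
    ((∃ m : ℕ, PlaneCurve.JordanBlocksAllOfSize (PlaneCurve.A f) 0 m) →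
      ∀ q : Polynomial k, minpoly k (PlaneCurve.A f) = Polynomial.X * q →
      ∀ Θ : PlaneCurve.Poly k,
        PlaneCurve.cls f Θ = PlaneCurve.cls f (Polynomial.aeval f q) →
        PlaneCurve.cls f Θ ∈ LinearMap.ker (PlaneCurve.A f) ∧
        LinearMap.range (PlaneCurve.mulMap f Θ) = LinearMap.ker (PlaneCurve.A f)) ∧
    (∀ σ : k →+* ℂ,
      (∀ p : Fin 2 → ℂ, PlaneCurve.IsSingularPoint (MvPolynomial.map σ f) p →
        PlaneCurve.IsQuasiHomogeneousAt (MvPolynomial.map σ f) p) →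
      PlaneCurve.JordanBlocksAllOfSize (PlaneCurve.A f) 0 1) := by
  have hfin := hf.finite
  refine ⟨fun Θ hker hrange => ⟨?_, fun ω hω => ?_⟩, ?_, fun σ hσ => ?_⟩
  · exact PlaneCurve.exists_wedge_eq (PlaneCurve.mem_ker_A_iff.mp hker)
  · exact PlaneCurve.E_eq_span hfin hrange hω
  · rintro ⟨m, hm⟩ q hq Θ hΘ
    have hrange : LinearMap.range (PlaneCurve.mulMap f Θ) = LinearMap.ker (PlaneCurve.A f) := by
      rw [← hm.range_aeval_eq_ker hq, PlaneCurve.aeval_A, PlaneCurve.mulMap, hΘ]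
      rfl
    refine ⟨?_, hrange⟩
    rw [← hrange]
    exact ⟨1, mul_one _⟩
  · apply PlaneCurve.jordanBlocksAllOfSize_one
    intro v hv
    obtain ⟨P, rfl⟩ := Ideal.Quotient.mk_surjective v
    have h2 : f * (f * P) ∈ PlaneCurve.jacob f := Ideal.Quotient.eq_zero_iff_mem.mp hv
    have h3 := PlaneCurve.map_mem_jacob σ h2
    rw [map_mul, map_mul] at h3
    have h4 := PlaneCurve.mul_mem_jacob_of_quasiHomogeneous hσ h3
    rw [← map_mul] at h4
    exact Ideal.Quotient.eq_zero_iff_mem.mpr (PlaneCurve.mem_jacob_of_map_mem σ h4)
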